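/- **Setting.** Let $(V,E,\ell)$ be a finite connected multigraph (loops and multiple edges allowed) with edge lengths $\ell(e)\in(0,\infty)$, and let $G$ be its metric realization, obtained from the vertices and the intervals $[0,\ell(e)]$, $e\in E$, by gluing endpoints to vertices; $(V,E,\ell)$ is called a model of $G$. Let $H^1(G)$ be the space of continuous functions $f\colon G\to\mathbb R$ with $f|_e\in H^1((0,\ell(e)))$ for all $e\in E$, and let $q(f,g)=\int_G f'g'\,dx$. For a Borel probability measure $\mu$ on $G$, let $H^1(G,\mu)$ be the space of those $f\in H^1(G)$ that are harmonic on $G\setminus\operatorname{supp}\mu$, i.e. $q(f,g)=0$ for all $g\in H^1(G)$ vanishing on $\operatorname{supp}\mu$. Let $H_\mu$ be the self-adjoint operator in $L^2(G,\mu)$ given by: $f\in\operatorname{dom}(H_\mu)$ and $H_\mu f=g$ if and only if $f\in H^1(G,\mu)$, $g\in L^2(G,\mu)$ and $q(f,\varphi)=\int_G g\varphi\,d\mu$ for all $\varphi\in H^1(G,\mu)$. Let $0=\lambda_0(H_\mu)<\lambda_1(H_\mu)\le\dots$ be its eigenvalues, counted with multiplicity, with $\lambda_k(H_\mu)=+\infty$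 if there are fewer than $k+1$ of them, and put $$\lambda_1^{\min}(G)=\min_{\mu}\lambda_1(H_\mu),$$ the minimum being over all Borel probability measures $\mu$ on $G$. For $Y\subset V$ let $\delta Y$ be the set of edges connecting a vertex in $Y$ with a vertex in $V\setminus Y$, and $|\delta Y|=\sum_{e\in\delta Y}1/\ell(e)$. The Cheeger-type constant of the model is $$h(G)=\min\Big\{\min_{\emptyset\subsetneq Y\subsetneq V}|\delta Y|,\ \min_{e_1\ne e_2\in E}\Big(\frac1{\ell(e_1)}+\frac1{\ell(e_2)}\Big),\ \min_{e\in E}\frac4{\ell(e)}\Big\},$$ where a minimum over the empty set is $+\infty$. A model is essential if it has no vertex of degree two (loops count twice in the degree) or consists of one vertex and one loop. **Proposition.** For every metric graph $G$ and every model of it (in particular for every essential model), $$\lambda_1^{\min}(G)\le 4\,h(G).$$ The bound is sharp. Equality holds * for the path graph $P=[0,1]$ (two vertices joined by one edge of length $1$; this model is essential), where $h(P)=1$; * for every $n\ge2$ for the equilateral $n$-pumpkin $G_n$ (two vertices joined by $n$ edges of length $1/n$; this model is essential if $n\ge3$), where $h(G_n)=2n$; * for the circle of length $1$ with its essential model (one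 vertex and one loop of length $1$; as a metric graph it is $G_2$), where $h=4$. -/

import Mathlib

open MeasureTheory Set
open scoped ENNReal ContDiff

noncomputable section

/-- A model `(V, E, ℓ)` of a metric graph: a connected multigraph (loops and multiple edges are
allowed) with vertex set `V` and edge set `E`, each edge `e` having an orientation, from `src e` to
`tgt e`, and a length `len e > 0`. -/
structure MetricGraph (V : Type*) (E : Type*) where
  src : E → V
  tgt : E → V
  len : E → ℝ
  len_pos : ∀ e, 0 < len e
  connected : (SimpleGraph.fromRel fun u v => ∃ e, src e = u ∧ tgt e = v).Connected

/-- `g` is a weak (distributional) derivative of `u` on the interval `(0, L)`. -/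
def IsWeakDeriv (L : ℝ) (u g : ℝ → ℝ) : Prop :=
  ∀ φ : ℝ → ℝ, ContDiff ℝ ∞ φ → HasCompactSupport φ → tsupport φ ⊆ Ioo 0 L →
    ∫ t in Ioo 0 L, u t * deriv φ t = -∫ t in Ioo 0 L, g t * φ t

/-- `u` belongs to the Sobolev space `H¹((0, L))`. -/
def MemSobolev (L : ℝ) (u : ℝ → ℝ) : Prop :=
  MemLp u 2 (volume.restrict (Ioo 0 L)) ∧
    ∃ g : ℝ → ℝ, MemLp g 2 (volume.restrict (Ioo 0 L)) ∧ IsWeakDeriv L u g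

open Classical in
/-- The weak derivative of `u ∈ H¹((0, L))`, unique up to a null set. -/
def weakDeriv (L : ℝ) (u : ℝ → ℝ) : ℝ → ℝ :=
  if h : MemSobolev L u then h.2.choose else 0

namespace MetricGraph

variable {V E : Type*} (G : MetricGraph V E)

/-- The endpoints `0` and `ℓ(e)` of the interval `[0, ℓ(e)]` are glued to the initial and the
terminal vertex of `e`. -/
inductive Glue : V ⊕ (Σ e : E, Icc (0 : ℝ) (G.len e)) →
    V ⊕ (Σ e : E, Icc (0 : ℝ) (G.len e)) → Prop
  | src (e : E) : Glue (Sum.inl (G.src e)) (Sum.inr ⟨e, 0, le_rfl, (G.len_pos e).le⟩)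
  | tgt (e : E) : Glue (Sum.inl (G.tgt e)) (Sum.inr ⟨e, G.len e, (G.len_pos e).le, le_rfl⟩)

/-- The metric realization of the model: the disjoint union of the vertices and of the intervals
`[0, ℓ(e)]`, with endpoints glued to vertices. -/
def Space : Type _ := Quot G.Glue

/-- The quotient topology, where the vertex set is discrete. -/
instance : TopologicalSpace G.Space :=
  letI : TopologicalSpace V := ⊥
  inferInstanceAs (TopologicalSpace (Quot G.Glue))

instance : MeasurableSpace G.Space := borel G.Space

instance : BorelSpace G.Space := ⟨rfl⟩

/-- The point with coordinate `t ∈ [0, ℓ(e)]` on the edge `e` (`t` is clamped to this interval). -/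
def edgePoint (e : E) (t : ℝ) : G.Space :=
  Quot.mk G.Glue (Sum.inr ⟨e, projIcc 0 (G.len e) (G.len_pos e).le t⟩)

/-- The restriction `f_e` of a function on the graph to the edge `e`. -/
def onEdge (f : G.Space → ℝ) (e : E) (t : ℝ) : ℝ := f (G.edgePoint e t)

/-- The Sobolev space `H¹(G)`. -/
def H1 : Set (G.Space → ℝ) :=
  {f | Continuous f ∧ ∀ e, MemSobolev (G.len e) (G.onEdge f e)}

/-- The energy form `q(f, g) = ∫_G f' g' dx`. -/
def energy [Fintype E] (f g : G.Space → ℝ) : ℝ :=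
  ∑ e, ∫ t in Ioo 0 (G.len e),
    weakDeriv (G.len e) (G.onEdge f e) t * weakDeriv (G.len e) (G.onEdge g e) t

/-- `f ∈ H¹(G)` is harmonic on the open set `O`. -/
def IsHarmonicOn [Fintype E] (f : G.Space → ℝ) (O : Set G.Space) : Prop :=
  f ∈ G.H1 ∧ ∀ g ∈ G.H1, (∀ x ∉ O, g x = 0) → G.energy f g = 0

/-- The space `H¹(G, μ)` of the functions in `H¹(G)` that are harmonic outside the support
of `μ`. -/
def H1μ [Fintype E] (μ : Measure G.Space) : Set (G.Space → ℝ) :=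
  {f | f ∈ G.H1 ∧ G.IsHarmonicOn f μ.supportᶜ}

/-- `f ∈ dom(H_μ)` and `H_μ f = g`, where `H_μ` is the self-adjoint operator in `L²(G, μ)` generated
by the restriction of the energy form to `H¹(G, μ)`. -/
def IsLaplacian [Fintype E] (μ : Measure G.Space) (f g : G.Space → ℝ) : Prop :=
  f ∈ G.H1μ μ ∧ MemLp g 2 μ ∧ ∀ φ ∈ G.H1μ μ, G.energy f φ = ∫ x, g x * φ x ∂μ

/-- `f` is an eigenfunction of `H_μ` for the eigenvalue `ν`. -/
def IsEigenfunction [Fintype E] (μ : Measure G.Space) (ν : ℝ) (f : G.Space → ℝ) : Prop :=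
  f ≠ 0 ∧ G.IsLaplacian μ f (ν • f)

/-- `λ_k(H_μ)`, `k = 0, 1, 2, …`: the `k`-th term in the increasing enumeration of the eigenvalues
of `H_μ`, counted with multiplicity, that is, the least `t` for which there are `k + 1` linearly
independent eigenfunctions with eigenvalues at most `t`. It is `∞` if there are fewer than `k + 1`
eigenvalues. Functions in `H¹(G, μ)` that agree `μ`-almost everywhere are equal, so linear
independence as functions is linear independence in `L²(G, μ)`. -/
def eigenvalue [Fintype E] (μ : Measure G.Space) (k : ℕ) : ℝ≥0∞ :=
  sInf {t | ∃ (ν : Fin (k + 1) → ℝ) (f : Fin (k + 1) → G.Space → ℝ), LinearIndependent ℝ f ∧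
    ∀ i, G.IsEigenfunction μ (ν i) (f i) ∧ ENNReal.ofReal (ν i) ≤ t}

/-- The `k`-th optimal eigenvalue `λ_k^min(G)`: the infimum (which is attained) of `λ_k(H_μ)`
over all Borel probability measures `μ` on the graph. -/
def optimalEigenvalue [Fintype E] (k : ℕ) : ℝ≥0∞ :=
  ⨅ μ : ProbabilityMeasure G.Space, G.eigenvalue (μ : Measure G.Space) k

/-- The combinatorial boundary `δY`: the edges between `Y` and its complement. -/
def boundary (Y : Set V) : Set E :=
  {e | (G.src e ∈ Y ∧ G.tgt e ∉ Y) ∨ (G.src e ∉ Y ∧ G.tgt e ∈ Y)}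

open Classical in
/-- The volume `|δY|` of the combinatorial boundary. -/
def boundaryVolume [Fintype E] (Y : Set V) : ℝ :=
  ∑ e with e ∈ G.boundary Y, 1 / G.len e

/-- The Cheeger-type constant. All minima are over finite sets; a minimum over the empty set
is `∞`. -/
def cheeger [Fintype E] : ℝ≥0∞ :=
  (⨅ (Y : Set V) (_ : Y.Nonempty ∧ Y ≠ univ), ENNReal.ofReal (G.boundaryVolume Y)) ⊓
  (⨅ (e₁ : E) (e₂ : E) (_ : e₁ ≠ e₂), ENNReal.ofReal (1 / G.len e₁ + 1 / G.len e₂)) ⊓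
  (⨅ e : E, ENNReal.ofReal (4 / G.len e))

open Classical in
/-- The degree of a vertex, with loops counted twice. -/
def degree [Fintype E] (v : V) : ℕ :=
  Finset.card {e | G.src e = v} + Finset.card {e | G.tgt e = v}

/-- The model is essential: it has no vertices of degree two, or it consists of one vertex and one
loop. -/
def IsEssential [Fintype E] : Prop :=
  (∀ v, G.degree v ≠ 2) ∨ (Nat.card V = 1 ∧ Fintype.card E = 1)

/-- The path graph `P = [0, 1]`: two vertices joined by one edge of length `1`. -/
def pathGraph : MetricGraph (Fin 2) Unit where
  src _ := 0
  tgt _ := 1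
  len _ := 1
  len_pos _ := one_pos
  connected := by
    have : Nonempty (Fin 2) := ⟨0⟩
    refine ⟨fun u v => ?_⟩
    by_cases h : u = v
    · exact h ▸ SimpleGraph.Reachable.refl u
    · refine SimpleGraph.Adj.reachable ⟨h, ?_⟩
      fin_cases u <;> fin_cases v <;> simp_all

/-- The equilateral `n`-pumpkin: two vertices joined by `n` edges of length `1 / n`. -/
def pumpkin (n : ℕ) (hn : 2 ≤ n) : MetricGraph (Fin 2) (Fin n) where
  src _ := 0
  tgt _ := 1
  len _ := 1 / n
  len_pos _ := by positivity
  connected := by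
    have : Nonempty (Fin 2) := ⟨0⟩
    have : Nonempty (Fin n) := ⟨⟨0, by omega⟩⟩
    refine ⟨fun u v => ?_⟩
    by_cases h : u = v
    · exact h ▸ SimpleGraph.Reachable.refl u
    · refine SimpleGraph.Adj.reachable ⟨h, ?_⟩
      fin_cases u <;> fin_cases v <;> simp_all

/-- The circle of length one: one vertex and one loop of length `1`. It is the essential model of
the equilateral `2`-pumpkin. -/
def circle : MetricGraph Unit Unit where
  src _ := ()
  tgt _ := ()
  len _ := 1
  len_pos _ := one_pos
  connected := by
    have : Nonempty Unit := ⟨()⟩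
    exact ⟨fun u v => SimpleGraph.Reachable.refl u⟩

end MetricGraph

end

/-! ### Weak derivatives on an interval -/

/-! Upper bound: let `μ` put mass 1/2 at each of two points x, y, and let f be 1 at x, -1 at y and
harmonic elsewhere. Every g in H¹(G) differs by a combination of 1 and f from a function vanishing
at x and y, so q(f,g) = q(f,f)(g(x)-g(y))/2 = q(f,f)∫fg dμ. Thus f is an eigenfunction with
eigenvalue q(f,f). By the Dirichlet principle (`IsQuarterLinear.exists_harmonic`) q(f,f) is at most
the energy of a competitor with these two values (`IsQuarterLinear.optimalEigenvalue_one_le`), and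
one explicit competitor for each of the three terms of the Cheeger-type constant gives the bound.
The competitors are linear on quarters of edges and x, y are vertices or quarter points, so energies
only see increments over quarters, and f comes from an orthogonal projection in a finite-dimensional
Euclidean space.

Lower bound in the examples: for any `μ`, a nonconstant eigenfunction f with eigenvalue ν has mean
zero. If m and M are its extreme values, integrating (f-m)(M-f) ≥ 0 gives ∫f² ≤ -mM ≤ (M-m)²/4.
Since q(f,f) = ν∫f², an estimate C(f(x)-f(y))² ≤ 4q(f,f) for all x, y forces C ≤ ν
(`le_optimalEigenvalue_one`). Such estimates come from Cauchy–Schwarz along a path or a cycle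
through x and y. -/

theorem setIntegral_mul_eq_integral {s : Set ℝ} {φ : ℝ → ℝ} (hs : tsupport φ ⊆ s) (u : ℝ → ℝ) :
    ∫ t in s, u t * φ t = ∫ t, φ t * u t := by
  rw [setIntegral_eq_integral_of_forall_compl_eq_zero]
  · simp_rw [mul_comm]
  · intro t ht
    rw [image_eq_zero_of_notMem_tsupport fun h => ht (hs h), mul_zero]

/-- The fundamental lemma of the calculus of variations on an interval. -/
theorem ae_eq_zero_of_setIntegral_mul_eq_zero {L : ℝ} {w : ℝ → ℝ}
    (hw : IntegrableOn w (Ioo 0 L))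
    (h : ∀ φ : ℝ → ℝ, ContDiff ℝ ∞ φ → HasCompactSupport φ → tsupport φ ⊆ Ioo 0 L →
      ∫ t in Ioo 0 L, w t * φ t = 0) :
    ∀ᵐ t ∂(volume.restrict (Ioo 0 L)), w t = 0 := by
  rw [ae_restrict_iff' measurableSet_Ioo]
  refine isOpen_Ioo.ae_eq_zero_of_integral_contDiff_smul_eq_zero hw.locallyIntegrableOn ?_
  intro φ h1 h2 h3
  simpa [setIntegral_mul_eq_integral h3] using h φ h1 h2 h3

theorem MeasureTheory.IntegrableOn.mul_of_hasCompactSupport {L : ℝ} {φ w : ℝ → ℝ} (hw : IntegrableOn w (Ioo 0 L))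
    (hφ : Continuous φ) (hc : HasCompactSupport φ) :
    IntegrableOn (fun t => w t * φ t) (Ioo 0 L) := by
  obtain ⟨C, hC⟩ := hc.exists_bound_of_continuous hφ
  exact hw.mul_bdd hφ.aestronglyMeasurable (Filter.Eventually.of_forall hC)

/-- Weak derivatives are unique up to null sets. -/
theorem IsWeakDeriv.ae_eq {L : ℝ} {u g g' : ℝ → ℝ} (h : IsWeakDeriv L u g)
    (h' : IsWeakDeriv L u g') (hg : IntegrableOn g (Ioo 0 L)) (hg' : IntegrableOn g' (Ioo 0 L)) :
    ∀ᵐ t ∂(volume.restrict (Ioo 0 L)), g t = g' t := by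
  have key := ae_eq_zero_of_setIntegral_mul_eq_zero (w := fun t => g t - g' t) (hg.sub hg') ?_
  · filter_upwards [key] with t ht using sub_eq_zero.mp ht
  · intro φ h1 h2 h3
    simp_rw [sub_mul]
    rw [integral_sub (IntegrableOn.mul_of_hasCompactSupport hg h1.continuous h2)
      (IntegrableOn.mul_of_hasCompactSupport hg' h1.continuous h2)]
    linarith [h φ h1 h2 h3, h' φ h1 h2 h3]

/-- A primitive of an integrable function `g` has the weak derivative `g`. -/
theorem isWeakDeriv_of_eq_integral {L c : ℝ} (hL : 0 < L) {u g : ℝ → ℝ}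
    (hg : IntegrableOn g (Ioo 0 L)) (hu : ∀ t ∈ Icc 0 L, u t = c + ∫ s in 0..t, g s) :
    IsWeakDeriv L u g := by
  intro φ h1 h2 h3
  have hgi : IntervalIntegrable g volume 0 L :=
    (intervalIntegrable_iff_integrableOn_Ioo_of_le hL.le).mpr hg
  set P : ℝ → ℝ := fun t => c + ∫ s in 0..t, g s with hP
  have hPac : AbsolutelyContinuousOnInterval P 0 L :=
    (LipschitzWith.const c).lipschitzOnWith.absolutelyContinuousOnInterval.add
      (hgi.absolutelyContinuousOnInterval_intervalIntegral (by simp))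
  have hφac : AbsolutelyContinuousOnInterval φ 0 L :=
    (h1.contDiffOn.of_le (by simp)).absolutelyContinuousOnInterval
  -- Integration by parts for absolutely continuous functions; the boundary terms vanish because `φ`
  -- is supported inside the interval.
  have key := hPac.integral_mul_deriv_eq_deriv_mul hφac
  have z : ∀ t ∉ Ioo 0 L, φ t = 0 := fun t ht => image_eq_zero_of_notMem_tsupport fun h => ht (h3 h)
  rw [z 0 (by simp), z L (by simp), mul_zero, mul_zero, sub_zero, zero_sub] at key
  have e1 : ∫ t in Ioo 0 L, u t * deriv φ t = ∫ t in 0..L, P t * deriv φ t := by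
    rw [intervalIntegral.integral_of_le hL.le, integral_Ioc_eq_integral_Ioo]
    refine setIntegral_congr_fun measurableSet_Ioo fun t ht => ?_
    simp only [hu t ⟨ht.1.le, ht.2.le⟩, hP]
  have e2 : ∫ t in Ioo 0 L, g t * φ t = ∫ t in 0..L, deriv P t * φ t := by
    rw [← integral_Ioc_eq_integral_Ioo, ← intervalIntegral.integral_of_le hL.le]
    refine intervalIntegral.integral_congr_ae ?_
    filter_upwards [hgi.ae_hasDerivAt_integral] with t ht hmem
    rw [((ht (uIoc_subset_uIcc hmem) 0 (by simp)).const_add c).deriv]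
  rw [e1, e2, key]

/-- A test function of integral zero on `(0, L)` is the derivative of a test function. -/
theorem exists_testFunction_deriv_eq {L : ℝ} (hL : 0 < L) {η : ℝ → ℝ} (h1 : ContDiff ℝ ∞ η)
    (h2 : HasCompactSupport η) (h3 : tsupport η ⊆ Ioo 0 L) (h0 : ∫ t in Ioo 0 L, η t = 0) :
    ∃ Φ : ℝ → ℝ, ContDiff ℝ ∞ Φ ∧ HasCompactSupport Φ ∧ tsupport Φ ⊆ Ioo 0 L ∧ deriv Φ = η := by
  obtain ⟨a, b, hab, ha, hb, hs⟩ : ∃ a b : ℝ, a ≤ b ∧ 0 < a ∧ b < L ∧ tsupport η ⊆ Icc a b := by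
    rcases (tsupport η).eq_empty_or_nonempty with he | hne
    · exact ⟨L / 2, L / 2, le_rfl, by linarith, by linarith, by simp [he]⟩
    · have hk : IsCompact (tsupport η) := h2
      refine ⟨sInf (tsupport η), sSup (tsupport η), ?_, (h3 (hk.sInf_mem hne)).1,
        (h3 (hk.sSup_mem hne)).2, ?_⟩
      · exact csInf_le_csSup hne hk.bddBelow hk.bddAbove
      · exact subset_Icc_csInf_csSup hk.bddBelow hk.bddAbove
  have z : ∀ t ∉ Icc a b, η t = 0 := fun t ht =>
    image_eq_zero_of_notMem_tsupport fun h => ht (hs h)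
  set Φ : ℝ → ℝ := fun t => ∫ s in 0..t, η s with hΦ
  have hd : ∀ t, HasDerivAt Φ (η t) t := fun t =>
    intervalIntegral.integral_hasDerivAt_right (h1.continuous.intervalIntegrable _ _)
      h1.continuous.stronglyMeasurable.stronglyMeasurableAtFilter h1.continuous.continuousAt
  have hderiv : deriv Φ = η := funext fun t => (hd t).deriv
  have hleft : ∀ t < a, Φ t = 0 := by
    intro t ht
    refine intervalIntegral.integral_zero_ae (Filter.Eventually.of_forall fun s hs' => z s ?_)
    rintro ⟨h, -⟩
    rcases le_total 0 t with h' | h'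
    · rw [uIoc_of_le h'] at hs'; linarith [hs'.2]
    · rw [uIoc_of_ge h'] at hs'; linarith [hs'.2]
  -- This is where the zero mean of `η` enters: the primitive returns to 0 after the support.
  have hright : ∀ t, b < t → Φ t = 0 := by
    intro t ht
    have hL0 : Φ L = 0 := by
      rw [hΦ]
      simp only
      rw [intervalIntegral.integral_of_le hL.le, integral_Ioc_eq_integral_Ioo, h0]
    have : (∫ s in 0..L, η s) + ∫ s in L..t, η s = ∫ s in 0..t, η s :=
      intervalIntegral.integral_add_adjacent_intervals (h1.continuous.intervalIntegrable _ _)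
        (h1.continuous.intervalIntegrable _ _)
    have h' : ∫ s in L..t, η s = 0 := by
      refine intervalIntegral.integral_zero_ae (Filter.Eventually.of_forall fun s hs' => z s ?_)
      rintro ⟨-, h⟩
      rcases le_total L t with h' | h'
      · rw [uIoc_of_le h'] at hs'; linarith [hs'.1]
      · rw [uIoc_of_ge h'] at hs'; linarith [hs'.1]
    change ∫ s in 0..t, η s = 0
    rw [← this, h']
    simpa using hL0
  have hsupp : tsupport Φ ⊆ Icc a b := by
    refine closure_minimal (fun t ht => ?_) isClosed_Icc
    by_contra hcon
    rw [mem_Icc, not_and_or, not_le, not_le] at hcon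
    exact ht (hcon.elim (hleft t) (hright t))
  refine ⟨Φ, ?_, isCompact_Icc.of_isClosed_subset (isClosed_tsupport _) hsupp,
    hsupp.trans fun t ht => ⟨ha.trans_le ht.1, ht.2.trans_lt hb⟩, hderiv⟩
  rw [contDiff_infty_iff_deriv, hderiv]
  exact ⟨fun t => (hd t).differentiableAt, h1⟩

/-- A continuous function with vanishing weak derivative is constant. -/
theorem eq_of_isWeakDeriv_zero {L : ℝ} (hL : 0 < L) {w : ℝ → ℝ} (hw : ContinuousOn w (Icc 0 L))
    (h : IsWeakDeriv L w 0) : ∀ t ∈ Icc 0 L, w t = w 0 := by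
  have hwi : IntegrableOn w (Ioo 0 L) :=
    (hw.integrableOn_compact isCompact_Icc).mono_set Ioo_subset_Icc_self
  let f : ContDiffBump (L / 2) := ⟨L / 8, L / 4, by linarith, by linarith⟩
  set ψ := f.normed volume with hψ
  have p1 : ContDiff ℝ ∞ ψ := f.contDiff_normed
  have p2 : HasCompactSupport ψ := f.hasCompactSupport_normed
  have p3 : tsupport ψ ⊆ Ioo 0 L := by
    rw [hψ, f.tsupport_normed_eq, Real.closedBall_eq_Icc]
    intro t ht
    change t ∈ Icc (L / 2 - L / 4) (L / 2 + L / 4) at ht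
    exact ⟨by linarith [ht.1], by linarith [ht.2]⟩
  have p4 : ∫ t in Ioo 0 L, ψ t = 1 := by
    have := setIntegral_mul_eq_integral p3 1
    simp only [Pi.one_apply, one_mul, mul_one] at this
    rw [this, hψ, f.integral_normed]
  -- The constant value of `w`: subtracting (∫φ)ψ from a test function `φ` leaves mean zero, hence a
  -- derivative Φ', which `w` annihilates. So ∫wφ = c∫φ.
  set c := ∫ t in Ioo 0 L, w t * ψ t with hc
  have hconst : ∀ᵐ t ∂(volume.restrict (Ioo 0 L)), w t - c = 0 := by
    refine ae_eq_zero_of_setIntegral_mul_eq_zero (hwi.sub (integrableOn_const (by simp))) ?_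
    intro φ h1 h2 h3
    set d := ∫ t in Ioo 0 L, φ t with hd
    have iφ : IntegrableOn φ (Ioo 0 L) := (h1.continuous.integrable_of_hasCompactSupport h2).integrableOn
    have iψ : IntegrableOn ψ (Ioo 0 L) := (p1.continuous.integrable_of_hasCompactSupport p2).integrableOn
    obtain ⟨Φ, q1, q2, q3, q4⟩ := exists_testFunction_deriv_eq hL (η := fun t => φ t - d * ψ t)
      (h1.sub (contDiff_const.mul p1)) (h2.sub p2.mul_left)
      ((tsupport_sub _ _).trans (union_subset h3 ((tsupport_mul_subset_right).trans p3))) (by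
        rw [integral_sub iφ (iψ.const_mul d), integral_const_mul, p4, mul_one, hd, sub_self])
    have := h Φ q1 q2 q3
    rw [q4] at this
    simp only [Pi.zero_apply, zero_mul, integral_zero, neg_zero, mul_sub] at this
    have i1 := IntegrableOn.mul_of_hasCompactSupport hwi h1.continuous h2
    have i2 := IntegrableOn.mul_of_hasCompactSupport hwi p1.continuous p2
    have e : ∀ t, w t * (d * ψ t) = d * (w t * ψ t) := fun t => by ring
    simp_rw [e] at this
    rw [integral_sub i1 (i2.const_mul d), integral_const_mul, ← hc] at this
    simp_rw [sub_mul]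
    rw [integral_sub i1 (iφ.const_mul c), integral_const_mul, ← hd]
    linarith
  have hae : w =ᵐ[volume.restrict (Ioo 0 L)] fun _ => c := by
    filter_upwards [hconst] with t ht using sub_eq_zero.mp ht
  have hIoo : EqOn w (fun _ => c) (Ioo 0 L) :=
    Measure.eqOn_open_of_ae_eq hae isOpen_Ioo (hw.mono Ioo_subset_Icc_self) continuousOn_const
  have hIcc : EqOn w (fun _ => c) (Icc 0 L) :=
    hIoo.of_subset_closure hw continuousOn_const Ioo_subset_Icc_self
      (by rw [closure_Ioo hL.ne])
  intro t ht
  rw [hIcc ht, hIcc ⟨le_rfl, hL.le⟩]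

/-- The fundamental theorem of calculus for a continuous function with integrable weak
derivative. -/
theorem IsWeakDeriv.integral_eq_sub {L : ℝ} (hL : 0 < L) {u g : ℝ → ℝ}
    (hu : ContinuousOn u (Icc 0 L)) (h : IsWeakDeriv L u g) (hg : IntegrableOn g (Ioo 0 L))
    {s t : ℝ} (hs : s ∈ Icc 0 L) (ht : t ∈ Icc 0 L) : ∫ r in s..t, g r = u t - u s := by
  have hgi : IntervalIntegrable g volume 0 L :=
    (intervalIntegrable_iff_integrableOn_Ioo_of_le hL.le).mpr hg
  set P : ℝ → ℝ := fun t => 0 + ∫ s in 0..t, g s with hP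
  have hPc : ContinuousOn P (Icc 0 L) := by
    have := (hgi.absolutelyContinuousOnInterval_intervalIntegral (c := 0) (by simp)).continuousOn
    rw [uIcc_of_le hL.le] at this
    exact continuousOn_const.add this
  have hPw : IsWeakDeriv L P g := isWeakDeriv_of_eq_integral hL hg fun t _ => rfl
  -- `u` and the primitive `P` share the weak derivative `g`, so they differ by a constant.
  have key := eq_of_isWeakDeriv_zero hL (w := fun t => u t - P t) (hu.sub hPc) (by
    intro φ h1 h2 h3
    have hd : Continuous (deriv φ) := h1.continuous_deriv (by simp)
    simp_rw [sub_mul]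
    rw [integral_sub (IntegrableOn.mul_of_hasCompactSupport ((hu.integrableOn_compact isCompact_Icc).mono_set
      Ioo_subset_Icc_self) hd h2.deriv) (IntegrableOn.mul_of_hasCompactSupport
      ((hPc.integrableOn_compact isCompact_Icc).mono_set Ioo_subset_Icc_self) hd h2.deriv),
      h φ h1 h2 h3, hPw φ h1 h2 h3]
    simp)
  have i : ∀ r ∈ Icc 0 L, IntervalIntegrable g volume 0 r := fun r hr =>
    hgi.mono_set (by rw [uIcc_of_le hr.1, uIcc_of_le hL.le]; exact Icc_subset_Icc_right hr.2)
  rw [← intervalIntegral.integral_interval_sub_left (i t ht) (i s hs)]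
  have k1 := key s hs
  have k2 := key t ht
  simp only [hP, zero_add] at k1 k2
  linarith

theorem MemSobolev.memLp_weakDeriv {L : ℝ} {u : ℝ → ℝ} (h : MemSobolev L u) :
    MemLp (weakDeriv L u) 2 (volume.restrict (Ioo 0 L)) := by
  rw [weakDeriv, dif_pos h]
  exact h.2.choose_spec.1

theorem MemSobolev.isWeakDeriv {L : ℝ} {u : ℝ → ℝ} (h : MemSobolev L u) :
    IsWeakDeriv L u (weakDeriv L u) := by
  rw [weakDeriv, dif_pos h]
  exact h.2.choose_spec.2

theorem MemSobolev.integrableOn_weakDeriv {L : ℝ} {u : ℝ → ℝ} (h : MemSobolev L u) :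
    IntegrableOn (weakDeriv L u) (Ioo 0 L) :=
  h.memLp_weakDeriv.integrable one_le_two

/-- A primitive of an `L²` function belongs to the Sobolev space. -/
theorem memSobolev_of_eq_integral {L c : ℝ} (hL : 0 < L) {u g : ℝ → ℝ}
    (hu' : ContinuousOn u (Icc 0 L))
    (hg : MemLp g 2 (volume.restrict (Ioo 0 L)))
    (hu : ∀ t ∈ Icc 0 L, u t = c + ∫ s in 0..t, g s) : MemSobolev L u := by
  refine ⟨?_, g, hg, isWeakDeriv_of_eq_integral hL (hg.integrable one_le_two) hu⟩
  obtain ⟨C, hC⟩ := isCompact_Icc.exists_bound_of_continuousOn hu'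
  refine MemLp.of_bound (C := C) ?_ ?_
  · exact (hu'.mono Ioo_subset_Icc_self).aestronglyMeasurable measurableSet_Ioo
  · rw [ae_restrict_iff' measurableSet_Ioo]
    exact Filter.Eventually.of_forall fun t ht => hC t (Ioo_subset_Icc_self ht)

theorem IsWeakDeriv.linear_comb {L : ℝ} {u v g h : ℝ → ℝ} (hu : IsWeakDeriv L u g)
    (hv : IsWeakDeriv L v h) (iu : IntegrableOn u (Ioo 0 L)) (iv : IntegrableOn v (Ioo 0 L))
    (ig : IntegrableOn g (Ioo 0 L)) (ih : IntegrableOn h (Ioo 0 L)) (a b : ℝ) :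
    IsWeakDeriv L (fun t => a * u t + b * v t) (fun t => a * g t + b * h t) := by
  intro φ h1 h2 h3
  have hd : Continuous (deriv φ) := h1.continuous_deriv (by simp)
  simp_rw [add_mul, mul_assoc]
  rw [integral_add ((iu.mul_of_hasCompactSupport hd h2.deriv).const_mul a)
    ((iv.mul_of_hasCompactSupport hd h2.deriv).const_mul b),
    integral_add ((ig.mul_of_hasCompactSupport h1.continuous h2).const_mul a)
    ((ih.mul_of_hasCompactSupport h1.continuous h2).const_mul b)]
  simp_rw [integral_const_mul]
  rw [hu φ h1 h2 h3, hv φ h1 h2 h3]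
  ring

theorem MemSobolev.linear_comb {L : ℝ} {u v : ℝ → ℝ} (hu : MemSobolev L u) (hv : MemSobolev L v)
    (a b : ℝ) : MemSobolev L (fun t => a * u t + b * v t) :=
  ⟨(hu.1.const_mul a).add (hv.1.const_mul b), _,
    (hu.memLp_weakDeriv.const_mul a).add (hv.memLp_weakDeriv.const_mul b),
    hu.isWeakDeriv.linear_comb hv.isWeakDeriv (hu.1.integrable one_le_two)
      (hv.1.integrable one_le_two) hu.integrableOn_weakDeriv hv.integrableOn_weakDeriv a b⟩

/-- Identifies the arbitrarily chosen `weakDeriv` whenever a primitive representation is known,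
which makes energies computable. -/
theorem weakDeriv_ae_eq {L c : ℝ} (hL : 0 < L) {u g : ℝ → ℝ} (hu' : ContinuousOn u (Icc 0 L))
    (hg : MemLp g 2 (volume.restrict (Ioo 0 L)))
    (hu : ∀ t ∈ Icc 0 L, u t = c + ∫ s in 0..t, g s) :
    ∀ᵐ t ∂(volume.restrict (Ioo 0 L)), weakDeriv L u t = g t :=
  have h := memSobolev_of_eq_integral hL hu' hg hu
  h.isWeakDeriv.ae_eq (isWeakDeriv_of_eq_integral hL (hg.integrable one_le_two) hu)
    h.integrableOn_weakDeriv (hg.integrable one_le_two)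

/-! ### Functions that are linear on each quarter of an interval -/

/-- The slope, on each quarter of `[0, L]`, of the function with the values `a 0, …, a 4` at the
endpoints of the quarters. -/
noncomputable def quarterSlope (L : ℝ) (a : ℕ → ℝ) (t : ℝ) : ℝ :=
  4 / L * (a (⌊4 * t / L⌋₊ + 1) - a ⌊4 * t / L⌋₊)

theorem quarterSlope_eq {L : ℝ} (hL : 0 < L) (a : ℕ → ℝ) {i : ℕ} {t : ℝ} (h : i * L / 4 ≤ t)
    (h' : t < (i + 1 : ℕ) * L / 4) : quarterSlope L a t = 4 / L * (a (i + 1) - a i) := by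
  have : ⌊4 * t / L⌋₊ = i := by
    have h0 : 0 ≤ t := le_trans (by positivity) h
    rw [Nat.floor_eq_iff (by positivity), le_div_iff₀ hL, div_lt_iff₀ hL]
    push_cast at h'
    constructor <;> linarith
  rw [quarterSlope, this]

/-- The slope is constant on each open quarter, so only the integrals of `h` over the quarters
matter. -/
theorem integral_quarterSlope_mul {L : ℝ} (hL : 0 < L) (a : ℕ → ℝ) (h : ℝ → ℝ) (k : ℕ)
    (hi : ∀ i < k, IntervalIntegrable h volume (i * L / 4) ((i + 1 : ℕ) * L / 4)) :
    ∫ t in 0..(k * L / 4), quarterSlope L a t * h t =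
      ∑ i ∈ Finset.range k,
        4 / L * (a (i + 1) - a i) * ∫ t in (i * L / 4)..((i + 1 : ℕ) * L / 4), h t := by
  have le : ∀ i : ℕ, i * L / 4 ≤ (i + 1 : ℕ) * L / 4 := fun i => by push_cast; nlinarith
  have eq : ∀ i : ℕ, ∀ t ∈ Ioo (i * L / 4) ((i + 1 : ℕ) * L / 4),
      4 / L * (a (i + 1) - a i) * h t = quarterSlope L a t * h t := fun i t ht => by
    rw [quarterSlope_eq hL a ht.1.le ht.2]
  have key := intervalIntegral.sum_integral_adjacent_intervals (μ := volume)
    (f := fun t => quarterSlope L a t * h t) (a := fun i : ℕ => i * L / 4) (n := k) (by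
      intro i hik
      have := (hi i hik).const_mul (4 / L * (a (i + 1) - a i))
      rw [intervalIntegrable_iff_integrableOn_Ioo_of_le (le i)] at this ⊢
      exact this.congr_fun (eq i) measurableSet_Ioo)
  simp only [Nat.cast_zero, zero_mul, zero_div] at key
  rw [← key]
  refine Finset.sum_congr rfl fun i _ => ?_
  rw [← intervalIntegral.integral_const_mul, intervalIntegral.integral_of_le (le i),
    intervalIntegral.integral_of_le (le i), integral_Ioc_eq_integral_Ioo,
    integral_Ioc_eq_integral_Ioo]
  exact (setIntegral_congr_fun measurableSet_Ioo (eq i)).symm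

theorem measurable_quarterSlope (L : ℝ) (a : ℕ → ℝ) : Measurable (quarterSlope L a) := by
  have h : Measurable fun t : ℝ => ⌊4 * t / L⌋₊ := by fun_prop
  exact (((measurable_from_nat (f := fun n => a (n + 1) - a n)).comp h).const_mul (4 / L))

theorem memLp_quarterSlope {L : ℝ} (hL : 0 < L) (a : ℕ → ℝ) :
    MemLp (quarterSlope L a) 2 (volume.restrict (Ioo 0 L)) := by
  refine MemLp.of_bound (C := ∑ i ∈ Finset.range 4, |4 / L * (a (i + 1) - a i)|)
    (measurable_quarterSlope L a).aestronglyMeasurable ?_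
  rw [ae_restrict_iff' measurableSet_Ioo]
  refine Filter.Eventually.of_forall fun t ht => ?_
  have : ⌊4 * t / L⌋₊ < 4 := by
    rw [Nat.floor_lt (div_nonneg (by linarith [ht.1]) hL.le), div_lt_iff₀ hL]
    push_cast
    linarith [ht.2]
  rw [Real.norm_eq_abs, quarterSlope]
  exact Finset.single_le_sum (f := fun i => |4 / L * (a (i + 1) - a i)|) (fun i _ => abs_nonneg _)
    (Finset.mem_range.mpr this)

/-- The function on `[0, L]` which is linear on each quarter, with the values `a 0, …, a 4` at the
endpoints of the quarters. -/
noncomputable def quarterLinear (L : ℝ) (a : ℕ → ℝ) (t : ℝ) : ℝ :=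
  a 0 + ∫ s in 0..t, quarterSlope L a s

theorem quarterLinear_apply {L : ℝ} (hL : 0 < L) (a : ℕ → ℝ) (k : ℕ) :
    quarterLinear L a (k * L / 4) = a k := by
  have := integral_quarterSlope_mul hL a (fun _ => 1) k fun i _ => intervalIntegrable_const
  simp only [mul_one, intervalIntegral.integral_const, smul_eq_mul] at this
  rw [quarterLinear, this]
  have e : ∀ i ∈ Finset.range k, 4 / L * (a (i + 1) - a i) *
      ((i + 1 : ℕ) * L / 4 - i * L / 4) = a (i + 1) - a i := fun i _ => by
    push_cast
    field_simp
    ring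
  rw [Finset.sum_congr rfl e, Finset.sum_range_sub]
  ring

theorem continuousOn_quarterLinear {L : ℝ} (hL : 0 < L) (a : ℕ → ℝ) :
    ContinuousOn (quarterLinear L a) (Icc 0 L) := by
  have hi : IntervalIntegrable (quarterSlope L a) volume 0 L :=
    (intervalIntegrable_iff_integrableOn_Ioo_of_le hL.le).mpr
      ((memLp_quarterSlope hL a).integrable one_le_two)
  have := (hi.absolutelyContinuousOnInterval_intervalIntegral (c := 0) (by simp)).continuousOn
  rw [uIcc_of_le hL.le] at this
  exact continuousOn_const.add this

/-! ### Points and topology of the metric realization -/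

namespace MetricGraph

variable {V E : Type*} (G : MetricGraph V E)

/-- The point of the graph given by a vertex. -/
def vertex (v : V) : G.Space := Quot.mk G.Glue (Sum.inl v)

theorem edgePoint_zero (e : E) : G.edgePoint e 0 = G.vertex (G.src e) := by
  rw [edgePoint, projIcc_left]
  exact (Quot.sound (Glue.src e)).symm

theorem edgePoint_len (e : E) : G.edgePoint e (G.len e) = G.vertex (G.tgt e) := by
  rw [edgePoint, projIcc_right]
  exact (Quot.sound (Glue.tgt e)).symm

theorem eq_vertex_or_edgePoint (x : G.Space) :
    (∃ v, x = G.vertex v) ∨ ∃ e, ∃ t ∈ Icc 0 (G.len e), x = G.edgePoint e t := by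
  induction x using Quot.ind with
  | mk p =>
    rcases p with v | ⟨e, t⟩
    · exact Or.inl ⟨v, rfl⟩
    · refine Or.inr ⟨e, t, t.2, ?_⟩
      rw [edgePoint, projIcc_val]

theorem continuous_edgePoint (e : E) : Continuous (G.edgePoint e) := by
  let _ : TopologicalSpace V := ⊥
  have h : Continuous (Quot.mk G.Glue) := continuous_quot_mk
  exact h.comp (continuous_inr.comp (continuous_sigmaMk.comp continuous_projIcc))

theorem continuous_onEdge {f : G.Space → ℝ} (hf : Continuous f) (e : E) :
    Continuous (G.onEdge f e) :=
  hf.comp (G.continuous_edgePoint e)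

theorem continuous_of_forall_onEdge {f : G.Space → ℝ}
    (hf : ∀ e, ContinuousOn (G.onEdge f e) (Icc 0 (G.len e))) : Continuous f := by
  let _ : TopologicalSpace V := ⊥
  have : DiscreteTopology V := ⟨rfl⟩
  have h : Continuous (f ∘ Quot.mk G.Glue) := by
    refine continuous_sum_dom.mpr ⟨continuous_of_discreteTopology, ?_⟩
    refine continuous_sigma fun e => ?_
    have := (hf e).domRestrict
    refine this.congr fun t => ?_
    simp only [domRestrict_apply, onEdge, edgePoint, projIcc_val]
    rfl
  exact isQuotientMap_quot_mk.continuous_iff.mpr h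

instance [Finite V] [Finite E] : CompactSpace G.Space := by
  let _ : TopologicalSpace V := ⊥
  have : DiscreteTopology V := ⟨rfl⟩
  exact inferInstanceAs (CompactSpace (Quot G.Glue))

instance [Nonempty V] : Nonempty G.Space := ⟨G.vertex (Classical.arbitrary V)⟩

/-! ### The Sobolev space of the graph -/

variable {G}

theorem const_mem_H1 (c : ℝ) : (fun _ => c) ∈ G.H1 :=
  ⟨continuous_const, fun e => memSobolev_of_eq_integral (c := c) (g := 0) (G.len_pos e)
    continuousOn_const MemLp.zero' fun t _ => by simp [onEdge]⟩

theorem linear_comb_mem_H1 {f g : G.Space → ℝ} (hf : f ∈ G.H1) (hg : g ∈ G.H1) (a b : ℝ) :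
    (fun x => a * f x + b * g x) ∈ G.H1 :=
  ⟨(hf.1.const_mul a).add (hg.1.const_mul b), fun e => (hf.2 e).linear_comb (hg.2 e) a b⟩

theorem integral_weakDeriv_onEdge {f : G.Space → ℝ} (hf : f ∈ G.H1) (e : E) {s t : ℝ}
    (hs : s ∈ Icc 0 (G.len e)) (ht : t ∈ Icc 0 (G.len e)) :
    ∫ r in s..t, weakDeriv (G.len e) (G.onEdge f e) r = G.onEdge f e t - G.onEdge f e s :=
  (hf.2 e).isWeakDeriv.integral_eq_sub (G.len_pos e) (G.continuous_onEdge hf.1 e).continuousOn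
    (hf.2 e).integrableOn_weakDeriv hs ht

theorem energy_const_left [Fintype E] (c : ℝ) (g : G.Space → ℝ) :
    G.energy (fun _ => c) g = 0 := by
  refine Finset.sum_eq_zero fun e _ => integral_eq_zero_of_ae ?_
  filter_upwards [weakDeriv_ae_eq (c := c) (g := 0) (u := G.onEdge (fun _ => c) e) (G.len_pos e)
    continuousOn_const MemLp.zero' fun t _ => by simp [onEdge]] with t ht
  simp [ht]

theorem energy_comm [Fintype E] (f g : G.Space → ℝ) : G.energy f g = G.energy g f := by
  simp only [energy, mul_comm]

/-! ### Functions that are linear on each quarter of each edge -/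

/-- `IsQuarterLinear f a`: on each edge `e`, the function `f` is linear on each quarter, with the
values `a e 0, …, a e 4` at the endpoints of the quarters. -/
def IsQuarterLinear (f : G.Space → ℝ) (a : E → ℕ → ℝ) : Prop :=
  ∀ e, ∀ t ∈ Icc 0 (G.len e), G.onEdge f e t = quarterLinear (G.len e) (a e) t

/-- The two endpoint conditions are exactly the compatibility with the gluing. -/
theorem exists_isQuarterLinear (w : V → ℝ) (a : E → ℕ → ℝ) (h0 : ∀ e, a e 0 = w (G.src e))
    (h4 : ∀ e, a e 4 = w (G.tgt e)) :
    ∃ f : G.Space → ℝ, IsQuarterLinear f a ∧ ∀ v, f (G.vertex v) = w v := by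
  refine ⟨Quot.lift (Sum.elim w fun p => quarterLinear (G.len p.1) (a p.1) p.2) ?_, ?_,
    fun v => rfl⟩
  · rintro _ _ (e | e)
    · simp [quarterLinear, h0]
    · have := quarterLinear_apply (G.len_pos e) (a e) 4
      rw [show ((4 : ℕ) : ℝ) * G.len e / 4 = G.len e by push_cast; ring] at this
      simp [this, h4]
  · intro e t ht
    simp only [onEdge, edgePoint, projIcc_of_mem _ ht, Sum.elim_inr]

theorem IsQuarterLinear.apply {f : G.Space → ℝ} {a : E → ℕ → ℝ} (h : IsQuarterLinear f a) (e : E)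
    {k : ℕ} (hk : k ≤ 4) : f (G.edgePoint e (k * G.len e / 4)) = a e k := by
  rw [← quarterLinear_apply (G.len_pos e) (a e) k]
  have := G.len_pos e
  have hk' : (k : ℝ) ≤ 4 := by exact_mod_cast hk
  exact h e _ ⟨by positivity, by nlinarith⟩

theorem IsQuarterLinear.mem_H1 {f : G.Space → ℝ} {a : E → ℕ → ℝ} (h : IsQuarterLinear f a) :
    f ∈ G.H1 := by
  have hc : ∀ e, ContinuousOn (G.onEdge f e) (Icc 0 (G.len e)) := fun e =>
    (continuousOn_quarterLinear (G.len_pos e) (a e)).congr (h e)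
  exact ⟨G.continuous_of_forall_onEdge hc, fun e => memSobolev_of_eq_integral (G.len_pos e) (hc e)
    (memLp_quarterSlope (G.len_pos e) (a e)) (h e)⟩

/-- The increment of a function over the `k`-th quarter of the edge `e`. -/
noncomputable def increment (f : G.Space → ℝ) (e : E) (k : ℕ) : ℝ :=
  f (G.edgePoint e ((k + 1 : ℕ) * G.len e / 4)) - f (G.edgePoint e (k * G.len e / 4))

/-- Only one argument has to be quarter-linear: on each quarter its constant slope pairs with g',
which integrates to an increment of `g`. Testing against all of H¹(G) thus becomes a
finite-dimensional condition. -/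
theorem IsQuarterLinear.energy_eq [Fintype E] {f g : G.Space → ℝ} {a : E → ℕ → ℝ}
    (h : IsQuarterLinear f a) (hg : g ∈ G.H1) :
    G.energy f g = ∑ e, ∑ k ∈ Finset.range 4,
      4 / G.len e * (increment f e k * increment g e k) := by
  refine Finset.sum_congr rfl fun e _ => ?_
  have hL := G.len_pos e
  have hfc : ContinuousOn (G.onEdge f e) (Icc 0 (G.len e)) :=
    (G.continuous_onEdge h.mem_H1.1 e).continuousOn
  have hae := weakDeriv_ae_eq hL hfc (memLp_quarterSlope hL (a e)) (h e)
  set g' := weakDeriv (G.len e) (G.onEdge g e) with hg'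
  have hmem : ∀ i : ℕ, i ≤ 4 → (i : ℝ) * G.len e / 4 ∈ Icc 0 (G.len e) := fun i hi => by
    have : (i : ℝ) ≤ 4 := by exact_mod_cast hi
    exact ⟨by positivity, by nlinarith⟩
  have e1 : ∫ t in Ioo 0 (G.len e), weakDeriv (G.len e) (G.onEdge f e) t * g' t =
      ∫ t in 0..((4 : ℕ) * G.len e / 4), quarterSlope (G.len e) (a e) t * g' t := by
    rw [show ((4 : ℕ) : ℝ) * G.len e / 4 = G.len e by push_cast; ring,
      intervalIntegral.integral_of_le hL.le, integral_Ioc_eq_integral_Ioo]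
    refine integral_congr_ae ?_
    filter_upwards [hae] with t ht
    rw [ht]
  have hi : IntervalIntegrable g' volume 0 (G.len e) :=
    (intervalIntegrable_iff_integrableOn_Ioo_of_le hL.le).mpr (hg.2 e).integrableOn_weakDeriv
  rw [e1, integral_quarterSlope_mul hL]
  · refine Finset.sum_congr rfl fun i hi => ?_
    have hi' := Finset.mem_range.mp hi
    rw [integral_weakDeriv_onEdge hg e (hmem i (by omega)) (hmem (i + 1) (by omega)), increment,
      h.apply e (show i ≤ 4 by omega), h.apply e (show i + 1 ≤ 4 by omega), mul_assoc]
    rfl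
  · intro i hi4
    refine hi.mono_set ?_
    rw [uIcc_of_le hL.le]
    exact uIcc_subset_Icc (hmem i (by omega)) (hmem (i + 1) (by omega))

/-- Every function on the graph has an interpolation that is linear on each quarter of each
edge. -/
theorem exists_interpolation (h : G.Space → ℝ) :
    ∃ (f : G.Space → ℝ) (a : E → ℕ → ℝ), IsQuarterLinear f a ∧
      (∀ v, f (G.vertex v) = h (G.vertex v)) ∧
      ∀ e, ∀ k : ℕ, k ≤ 4 → f (G.edgePoint e (k * G.len e / 4)) = h (G.edgePoint e (k * G.len e / 4)) := by
  obtain ⟨f, h1, h2⟩ := exists_isQuarterLinear (G := G) (fun v => h (G.vertex v))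
    (fun e k => h (G.edgePoint e (k * G.len e / 4)))
    (fun e => by simp [edgePoint_zero]) (fun e => by
      rw [show ((4 : ℕ) : ℝ) * G.len e / 4 = G.len e by push_cast; ring, edgePoint_len])
  exact ⟨f, _, h1, h2, fun e k hk => h1.apply e hk⟩

end MetricGraph

/-! ### The energy as a Euclidean inner product, and the Dirichlet principle -/

namespace MetricGraph

variable {V E : Type*} {G : MetricGraph V E}

/-- The endpoints of the quarters of the edges, and the vertices. -/
def IsNode (x : G.Space) : Prop :=
  (∃ v, x = G.vertex v) ∨ ∃ e, ∃ k : ℕ, k ≤ 4 ∧ x = G.edgePoint e (k * G.len e / 4)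

/-- The increments of a function over the quarters of the edges, weighted such that the energy
of functions that are linear on the quarters becomes the inner product. -/
noncomputable def incrementMap [Fintype E] (G : MetricGraph V E) :
    (G.Space → ℝ) →ₗ[ℝ] EuclideanSpace ℝ (E × Fin 4) where
  toFun f := WithLp.toLp 2 fun p => √(4 / G.len p.1) * increment f p.1 p.2
  map_add' f g := by
    ext p
    simp only [increment, Pi.add_apply, PiLp.add_apply]
    ring
  map_smul' c f := by
    ext p
    simp only [increment, Pi.smul_apply, PiLp.smul_apply, smul_eq_mul, RingHom.id_apply]
    ring

theorem IsQuarterLinear.energy_eq_inner [Fintype E] {f g : G.Space → ℝ} {a : E → ℕ → ℝ}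
    (h : IsQuarterLinear f a) (hg : g ∈ G.H1) :
    G.energy f g = inner ℝ (G.incrementMap f) (G.incrementMap g) := by
  rw [h.energy_eq hg, PiLp.inner_apply, Fintype.sum_prod_type]
  refine Finset.sum_congr rfl fun e _ => ?_
  rw [Finset.sum_range]
  refine Finset.sum_congr rfl fun k _ => ?_
  simp only [incrementMap, LinearMap.coe_mk, AddHom.coe_mk, RCLike.inner_apply, conj_trivial]
  have := Real.mul_self_sqrt (div_nonneg zero_le_four (G.len_pos e).le)
  linear_combination (-(increment f e k * increment g e k)) * this

/-- The energy factors through the linear map `incrementMap`, so linearity of the chosen weak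
derivatives is never needed. -/
theorem IsQuarterLinear.energy_linear_comb [Fintype E] {f g h : G.Space → ℝ} {a : E → ℕ → ℝ}
    (hf : IsQuarterLinear f a) (hg : g ∈ G.H1) (hh : h ∈ G.H1) (s t : ℝ) :
    G.energy f (fun x => s * g x + t * h x) = s * G.energy f g + t * G.energy f h := by
  have e : (fun x => s * g x + t * h x) = s • g + t • h := rfl
  rw [hf.energy_eq_inner hg, hf.energy_eq_inner hh,
    hf.energy_eq_inner (linear_comb_mem_H1 hg hh s t), e, map_add, map_smul, map_smul,
    inner_add_right, inner_smul_right, inner_smul_right]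

/-- The Dirichlet principle: among the functions with given values on a set of nodes, there is a
harmonic one, and it does not have more energy than a given one. -/
theorem IsQuarterLinear.exists_harmonic [Fintype E] {φ : G.Space → ℝ} {b : E → ℕ → ℝ}
    (hφ : IsQuarterLinear φ b) {S : Set G.Space} (hS : ∀ x ∈ S, IsNode x) :
    ∃ (f : G.Space → ℝ) (a : E → ℕ → ℝ), IsQuarterLinear f a ∧ (∀ x ∈ S, f x = φ x) ∧
      (∀ g ∈ G.H1, (∀ x ∈ S, g x = 0) → G.energy f g = 0) ∧ G.energy f f ≤ G.energy φ φ := by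
  let W : Submodule ℝ (G.Space → ℝ) :=
    { carrier := {g | g ∈ G.H1 ∧ ∀ x ∈ S, g x = 0}
      zero_mem' := ⟨const_mem_H1 0, fun _ _ => rfl⟩
      add_mem' := fun {f g} hf hg => ⟨by
        have := linear_comb_mem_H1 hf.1 hg.1 1 1
        simp only [one_mul] at this
        exact this, fun x hx => by simp [hf.2 x hx, hg.2 x hx]⟩
      smul_mem' := fun c f hf => ⟨by
        have := linear_comb_mem_H1 hf.1 hf.1 c 0
        simp only [zero_mul, add_zero] at this
        exact this, fun x hx => by simp [hf.2 x hx]⟩ }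
  set N := G.incrementMap
  set K := W.map N
  -- φ - w is the harmonic candidate at the level of increments: they are the component of those of
  -- `φ` orthogonal to `K`.
  obtain ⟨w, hw, hwz⟩ : ∃ w ∈ W, N w = K.starProjection (N φ) :=
    Submodule.mem_map.mp (K.starProjection_apply_mem (N φ))
  -- The function `w` need not be quarter-linear; interpolating φ - w changes neither its increments
  -- nor its values on `S`, since `S` consists of nodes.
  obtain ⟨f, a, hf, hfv, hfe⟩ := exists_interpolation (fun x => φ x - w x)
  have hfN : N f = N φ - K.starProjection (N φ) := by
    rw [← hwz, ← map_sub]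
    ext p
    have h1 := hfe p.1 p.2 (by omega)
    have h2 := hfe p.1 (p.2 + 1) (by omega)
    simp only [N, incrementMap, LinearMap.coe_mk, AddHom.coe_mk, increment, h1, h2, Pi.sub_apply]
  refine ⟨f, a, hf, fun x hx => ?_, fun g hg hgS => ?_, ?_⟩
  · have : f x = φ x - w x := by
      rcases hS x hx with ⟨v, rfl⟩ | ⟨e, k, hk, rfl⟩
      · exact hfv v
      · exact hfe e k hk
    rw [this, hw.2 x hx, sub_zero]
  · rw [hf.energy_eq_inner hg]
    change inner ℝ (N f) (N g) = 0
    rw [hfN]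
    exact K.starProjection_inner_eq_zero (N φ) (N g) (Submodule.mem_map_of_mem ⟨hg, hgS⟩)
  · rw [hf.energy_eq_inner hf.mem_H1, hφ.energy_eq_inner hφ.mem_H1]
    change inner ℝ (N f) (N f) ≤ inner ℝ (N φ) (N φ)
    rw [real_inner_self_eq_norm_sq, real_inner_self_eq_norm_sq, hfN]
    have : ‖N φ - K.starProjection (N φ)‖ ≤ ‖N φ‖ := by
      have := Kᗮ.norm_starProjection_apply_le (N φ)
      rwa [Submodule.starProjection_orthogonal_val] at this
    gcongr

/-! ### Two-point measures and their eigenfunctions -/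

theorem memLp_of_continuous [Finite V] [Finite E] {f : G.Space → ℝ} (hf : Continuous f)
    (μ : Measure G.Space) [IsFiniteMeasure μ] (p : ℝ≥0∞) : MemLp f p μ := by
  obtain ⟨C, hC⟩ := isCompact_univ.exists_bound_of_continuousOn hf.continuousOn
  exact MemLp.of_bound hf.aestronglyMeasurable C (Filter.Eventually.of_forall fun x => hC x trivial)

theorem integrable_of_continuous [Finite V] [Finite E] {f : G.Space → ℝ} (hf : Continuous f)
    (μ : Measure G.Space) [IsFiniteMeasure μ] : Integrable f μ :=
  (memLp_of_continuous hf μ 1).integrable le_rfl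

theorem isEigenfunction_one [Finite V] [Fintype E] (μ : Measure G.Space) [IsFiniteMeasure μ] :
    G.IsEigenfunction μ 0 fun _ => 1 := by
  have : Nonempty V := G.connected.nonempty
  refine ⟨fun h => one_ne_zero (congrFun h (Classical.arbitrary G.Space)),
    ⟨const_mem_H1 1, const_mem_H1 1, fun g _ _ => energy_const_left 1 g⟩, ?_, fun φ _ => ?_⟩
  · exact memLp_of_continuous (continuous_const.const_smul 0) μ 2
  · simp [energy_const_left]

/-- The measure with mass `1/2` at each of two points. -/
noncomputable def twoPointMeasure (x y : G.Space) : Measure G.Space :=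
  (2⁻¹ : ℝ≥0∞) • Measure.dirac x + (2⁻¹ : ℝ≥0∞) • Measure.dirac y

instance (x y : G.Space) : IsProbabilityMeasure (twoPointMeasure x y) := by
  constructor
  simp [twoPointMeasure, ENNReal.inv_two_add_inv_two]

theorem integral_twoPointMeasure [Finite V] [Finite E] {f : G.Space → ℝ} (hf : Continuous f)
    (x y : G.Space) : ∫ z, f z ∂twoPointMeasure x y = (f x + f y) / 2 := by
  have hx : Integrable f ((2⁻¹ : ℝ≥0∞) • Measure.dirac x) :=
    (integrable_of_continuous hf (Measure.dirac x)).smul_measure (by simp)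
  have hy : Integrable f ((2⁻¹ : ℝ≥0∞) • Measure.dirac y) :=
    (integrable_of_continuous hf (Measure.dirac y)).smul_measure (by simp)
  rw [twoPointMeasure, integral_add_measure hx hy, integral_smul_measure, integral_smul_measure,
    integral_dirac' _ _ hf.stronglyMeasurable, integral_dirac' _ _ hf.stronglyMeasurable]
  simp
  ring

/-- Only this inclusion is needed: a test function vanishing on the support then vanishes at both
points. -/
theorem mem_support_twoPointMeasure (x y : G.Space) :
    x ∈ (twoPointMeasure x y).support ∧ y ∈ (twoPointMeasure x y).support := by
  have h : ∀ z : G.Space, ∀ U ∈ nhds z, 0 < (2⁻¹ : ℝ≥0∞) * Measure.dirac z U := fun z U hU => by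
    rw [Measure.dirac_apply_of_mem (mem_of_mem_nhds hU)]
    simp
  constructor
  · refine (Measure.mem_support_iff_forall x).mpr fun U hU => ?_
    simp only [twoPointMeasure, Measure.add_apply, Measure.smul_apply, smul_eq_mul]
    exact (h x U hU).trans_le le_self_add
  · refine (Measure.mem_support_iff_forall y).mpr fun U hU => ?_
    simp only [twoPointMeasure, Measure.add_apply, Measure.smul_apply, smul_eq_mul]
    exact (h y U hU).trans_le le_add_self

/-- The energy of a function with the values `1` and `-1` at two nodes bounds the first optimal
eigenvalue. -/
theorem IsQuarterLinear.optimalEigenvalue_one_le [Finite V] [Fintype E] {φ : G.Space → ℝ}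
    {b : E → ℕ → ℝ} (hφ : IsQuarterLinear φ b) {x y : G.Space} (hx : IsNode x) (hy : IsNode y)
    (hφx : φ x = 1) (hφy : φ y = -1) :
    G.optimalEigenvalue 1 ≤ ENNReal.ofReal (G.energy φ φ) := by
  obtain ⟨f, a, hfl, hfφ, hharm, hle⟩ := hφ.exists_harmonic (S := {x, y}) (by
    rintro z (rfl | rfl)
    exacts [hx, hy])
  have hf := hfl.mem_H1
  have hfx : f x = 1 := by rw [hfφ x (by simp), hφx]
  have hfy : f y = -1 := by rw [hfφ y (by simp), hφy]
  set μ := twoPointMeasure x y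
  have hfμ : f ∈ G.H1μ μ := ⟨hf, hf, fun g hg hgμ => hharm g hg (by
    have hs := mem_support_twoPointMeasure x y
    rintro z (rfl | rfl)
    exacts [hgμ _ fun h => h hs.1, hgμ _ fun h => h hs.2])⟩
  have heig : G.IsEigenfunction μ (G.energy f f) f := by
    refine ⟨fun h => ?_, hfμ, memLp_of_continuous (hf.1.const_smul _) μ 2, fun g hg => ?_⟩
    · rw [h] at hfx
      simp at hfx
    -- With these coefficients g - c - d·f vanishes at `x` and `y`, so harmonicity gives q(f,g) =
    -- d·q(f,f).
    · set c := (g x + g y) / 2 with hc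
      set d := (g x - g y) / 2 with hd
      have h1 := linear_comb_mem_H1 (const_mem_H1 (G := G) 1) hf c d
      have key := hharm _ (linear_comb_mem_H1 hg.1 h1 1 (-1)) (by
        rintro z (rfl | rfl)
        · rw [hfx, hc, hd]; ring
        · rw [hfy, hc, hd]; ring)
      rw [hfl.energy_linear_comb hg.1 h1, hfl.energy_linear_comb (const_mem_H1 1) hf,
        energy_comm f (fun _ => 1), energy_const_left] at key
      have hint := integral_twoPointMeasure (f := fun z => (G.energy f f • f) z * g z)
        ((hf.1.const_smul _).mul hg.1.1) x y
      rw [hint]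
      simp only [Pi.smul_apply, smul_eq_mul, hfx, hfy]
      rw [hd] at key
      linarith
  refine (iInf_le _ ⟨μ, inferInstance⟩).trans (sInf_le ?_)
  refine ⟨![0, G.energy f f], ![fun _ => 1, f], ?_, fun i => ?_⟩
  · rw [LinearIndependent.pair_iff]
    intro s t hst
    have h1 := congrFun hst x
    have h2 := congrFun hst y
    simp only [Pi.add_apply, Pi.smul_apply, smul_eq_mul, hfx, hfy, Pi.zero_apply] at h1 h2
    constructor <;> linarith
  · fin_cases i
    · exact ⟨isEigenfunction_one μ, by simp⟩
    · exact ⟨heig, ENNReal.ofReal_le_ofReal hle⟩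

end MetricGraph

/-! ### Competitors for the three terms of the Cheeger-type constant -/

namespace MetricGraph

variable {V E : Type*} {G : MetricGraph V E}

theorem IsQuarterLinear.energy_self [Fintype E] {f : G.Space → ℝ} {a : E → ℕ → ℝ}
    (h : IsQuarterLinear f a) :
    G.energy f f = ∑ e, 4 / G.len e * ((a e 1 - a e 0) ^ 2 + (a e 2 - a e 1) ^ 2 +
      (a e 3 - a e 2) ^ 2 + (a e 4 - a e 3) ^ 2) := by
  rw [h.energy_eq h.mem_H1]
  refine Finset.sum_congr rfl fun e _ => ?_
  have hi : ∀ k < 4, increment f e k = a e (k + 1) - a e k := fun k hk => by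
    rw [increment, h.apply e (show k ≤ 4 by omega), h.apply e (show k + 1 ≤ 4 by omega)]
  simp only [Finset.sum_range_succ, Finset.sum_range_zero, hi 0 (by omega), hi 1 (by omega),
    hi 2 (by omega), hi 3 (by omega)]
  ring

/-- The competitor is 1 on `Y`, -1 on the other vertices and affine on edges; a jump of 2 across an
edge of the boundary costs 4/ℓ(e). -/
theorem optimalEigenvalue_one_le_boundaryVolume [Finite V] [Fintype E] {Y : Set V}
    (hY : Y.Nonempty) (hY' : Y ≠ univ) :
    G.optimalEigenvalue 1 ≤ 4 * ENNReal.ofReal (G.boundaryVolume Y) := by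
  classical
  obtain ⟨v, hv⟩ := hY
  obtain ⟨v', hv'⟩ := (ne_univ_iff_exists_notMem Y).mp hY'
  set w : V → ℝ := fun v => if v ∈ Y then 1 else -1 with hw
  obtain ⟨φ, hφ, hφv⟩ := exists_isQuarterLinear (G := G) w
    (fun e k => w (G.src e) + k / 4 * (w (G.tgt e) - w (G.src e))) (fun e => by simp)
    (fun e => by push_cast; ring)
  have key := hφ.optimalEigenvalue_one_le (Or.inl ⟨v, rfl⟩) (Or.inl ⟨v', rfl⟩)
    (by rw [hφv]; simp [hw, hv]) (by rw [hφv]; simp [hw, hv'])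
  refine key.trans (le_of_eq ?_)
  rw [show (4 : ℝ≥0∞) = ENNReal.ofReal 4 by simp, ← ENNReal.ofReal_mul (by norm_num),
    hφ.energy_self, boundaryVolume, Finset.mul_sum, Finset.sum_filter]
  congr 1
  refine Finset.sum_congr rfl fun e _ => ?_
  by_cases hs : G.src e ∈ Y <;> by_cases ht : G.tgt e ∈ Y <;>
    simp only [boundary, mem_ofPred_eq, hw, hs, ht, if_true, if_false, not_true, not_false_eq_true,
      and_true, and_false, or_true, or_false] <;> push_cast <;> ring

/-- The competitor is a tent of height 1 on `e₁` and one of height -1 on `e₂`, with peaks at the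
midpoints; each costs 4/ℓ. -/
theorem optimalEigenvalue_one_le_of_ne [Finite V] [Fintype E] {e₁ e₂ : E} (h : e₁ ≠ e₂) :
    G.optimalEigenvalue 1 ≤ 4 * ENNReal.ofReal (1 / G.len e₁ + 1 / G.len e₂) := by
  classical
  let m : ℕ → ℝ
    | 1 => 1 / 2
    | 2 => 1
    | 3 => 1 / 2
    | _ => 0
  set c : E → ℝ := fun e => if e = e₁ then 1 else if e = e₂ then -1 else 0 with hc
  have c1 : c e₁ = 1 := by simp [hc]
  have c2 : c e₂ = -1 := by simp [hc, h.symm]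
  obtain ⟨φ, hφ, -⟩ := exists_isQuarterLinear (G := G) (fun _ => 0) (fun e k => c e * m k)
    (fun e => by simp [m]) (fun e => by simp [m])
  have key := hφ.optimalEigenvalue_one_le (Or.inr ⟨e₁, 2, by norm_num, rfl⟩)
    (Or.inr ⟨e₂, 2, by norm_num, rfl⟩) (by rw [hφ.apply e₁ (by norm_num), c1]; simp [m])
    (by rw [hφ.apply e₂ (by norm_num), c2]; simp [m])
  refine key.trans (le_of_eq ?_)
  rw [show (4 : ℝ≥0∞) = ENNReal.ofReal 4 by simp, ← ENNReal.ofReal_mul (by norm_num),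
    hφ.energy_self, Fintype.sum_eq_add e₁ e₂ h, c1, c2]
  · congr 1
    simp only [m]
    ring
  · rintro e ⟨he1, he2⟩
    simp [hc, he1, he2]

/-- The competitor takes the values 0, 1, 0, -1, 0 at the quarter points of `e₀`, each quarter
costing 4/ℓ. This case is why edges are cut into quarters. -/
theorem optimalEigenvalue_one_le_len [Finite V] [Fintype E] (e₀ : E) :
    G.optimalEigenvalue 1 ≤ 4 * ENNReal.ofReal (4 / G.len e₀) := by
  classical
  let m : ℕ → ℝ
    | 1 => 1
    | 3 => -1
    | _ => 0
  set c : E → ℝ := fun e => if e = e₀ then 1 else 0 with hc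
  have c1 : c e₀ = 1 := by simp [hc]
  obtain ⟨φ, hφ, -⟩ := exists_isQuarterLinear (G := G) (fun _ => 0) (fun e k => c e * m k)
    (fun e => by simp [m]) (fun e => by simp [m])
  have key := hφ.optimalEigenvalue_one_le (Or.inr ⟨e₀, 1, by norm_num, rfl⟩)
    (Or.inr ⟨e₀, 3, by norm_num, rfl⟩) (by rw [hφ.apply e₀ (by norm_num), c1]; simp [m])
    (by rw [hφ.apply e₀ (by norm_num), c1]; simp [m])
  refine key.trans (le_of_eq ?_)
  rw [show (4 : ℝ≥0∞) = ENNReal.ofReal 4 by simp, ← ENNReal.ofReal_mul (by norm_num),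
    hφ.energy_self, Fintype.sum_eq_single e₀, c1]
  · congr 1
    simp only [m]
    ring
  · intro e he
    simp [hc, he]

/-- The first optimal eigenvalue is at most four times the Cheeger-type constant. -/
theorem optimalEigenvalue_one_le_cheeger [Finite V] [Fintype E] (G : MetricGraph V E) :
    G.optimalEigenvalue 1 ≤ 4 * G.cheeger := by
  rw [← ENNReal.div_le_iff' (by norm_num) (by norm_num)]
  refine le_inf (le_inf ?_ ?_) ?_
  · exact le_iInf₂ fun Y hY => ENNReal.div_le_of_le_mul'
      (optimalEigenvalue_one_le_boundaryVolume hY.1 hY.2)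
  · exact le_iInf fun e₁ => le_iInf₂ fun e₂ h => ENNReal.div_le_of_le_mul'
      (optimalEigenvalue_one_le_of_ne h)
  · exact le_iInf fun e => ENNReal.div_le_of_le_mul' (optimalEigenvalue_one_le_len e)

/-! ### Lower bounds -/

/-- A bound on the effective resistances gives a lower bound for the first optimal eigenvalue. -/
theorem le_optimalEigenvalue_one [Finite V] [Fintype E] {C : ℝ} (hC : 0 < C)
    (h : ∀ f ∈ G.H1, ∀ x y, C * (f x - f y) ^ 2 ≤ 4 * G.energy f f) :
    ENNReal.ofReal C ≤ G.optimalEigenvalue 1 := by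
  have : Nonempty V := G.connected.nonempty
  refine le_iInf fun μ' => le_sInf ?_
  rintro t ⟨ν, F, hlin, hF⟩
  set μ : Measure G.Space := (μ' : Measure G.Space) with hμ
  -- Two linearly independent functions cannot both be constant, so it suffices to treat a
  -- nonconstant eigenfunction.
  suffices hnu : ∀ (ν : ℝ) (f : G.Space → ℝ), G.IsEigenfunction μ ν f → (∃ x y, f x ≠ f y) →
      C ≤ ν by
    obtain ⟨i, x, y, hxy⟩ : ∃ i x y, F i x ≠ F i y := by
      by_contra! hcon
      obtain ⟨z⟩ : Nonempty G.Space := inferInstance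
      have hlin' : LinearIndependent (ι := Fin 2) ℝ F := hlin
      have hp := Fintype.linearIndependent_iff.mp hlin' ![F 1 z, -F 0 z] (by
        ext x
        rw [Fin.sum_univ_two]
        simp only [Matrix.cons_val_zero, Matrix.cons_val_one, Pi.add_apply,
          Pi.smul_apply, smul_eq_mul, Pi.zero_apply, hcon 0 x z, hcon 1 x z]
        ring) 1
      refine hlin.ne_zero 0 (funext fun x => ?_)
      rw [hcon 0 x z]
      simpa using hp
    exact (ENNReal.ofReal_le_ofReal (hnu _ _ (hF i).1 ⟨x, y, hxy⟩)).trans (hF i).2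
  rintro ν f ⟨-, hfμ, -, heig⟩ ⟨x, y, hxy⟩
  have hf : f ∈ G.H1 := hfμ.1
  have hq : 0 < G.energy f f := by
    have := h f hf x y
    have : 0 < (f x - f y) ^ 2 := by
      have := sub_ne_zero.mpr hxy
      positivity
    nlinarith
  have hff := heig f hfμ
  -- Testing against the constant 1 yields mean zero, once `ν` is known to be nonzero.
  have hf1 := heig (fun _ => 1) ⟨const_mem_H1 1, const_mem_H1 1, fun g _ _ => energy_const_left 1 g⟩
  simp only [Pi.smul_apply, smul_eq_mul, mul_one, mul_assoc] at hff hf1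
  rw [integral_const_mul] at hff hf1
  rw [energy_comm, energy_const_left] at hf1
  have hν : ν ≠ 0 := by
    rintro rfl
    rw [zero_mul] at hff
    exact hq.ne' hff
  have hmean : ∫ z, f z ∂μ = 0 := by simpa [hν] using hf1.symm
  obtain ⟨p, -, hp⟩ := isCompact_univ.exists_isMinOn univ_nonempty hf.1.continuousOn
  obtain ⟨q, -, hq'⟩ := isCompact_univ.exists_isMaxOn univ_nonempty hf.1.continuousOn
  have i1 := integrable_of_continuous hf.1 μ
  have i2 : Integrable (fun z => f z * f z) μ := integrable_of_continuous (hf.1.mul hf.1) μ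
  have i3 : Integrable (fun z => (f p + f q) * f z - f z * f z) μ := (i1.const_mul _).sub i2
  have hsq : ∫ z, f z * f z ∂μ ≤ -(f p * f q) := by
    -- The integrand is (f - min f)(max f - f), expanded.
    have h0 : 0 ≤ ∫ z, ((f p + f q) * f z - f z * f z - f p * f q) ∂μ := by
      refine integral_nonneg fun z => ?_
      have h1 : f p ≤ f z := hp (mem_univ z)
      have h2 : f z ≤ f q := hq' (mem_univ z)
      have := mul_nonneg (sub_nonneg.mpr h1) (sub_nonneg.mpr h2)
      simp only [Pi.zero_apply]
      linarith
    rw [integral_sub i3 (integrable_const _),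
      integral_sub (i1.const_mul _) i2, integral_const_mul, hmean] at h0
    simp at h0
    linarith
  have hpos : 0 < ∫ z, f z * f z ∂μ := by
    refine lt_of_le_of_ne (integral_nonneg fun z => mul_self_nonneg _) fun h0 => ?_
    rw [← h0, mul_zero] at hff
    exact hq.ne' hff
  have hb := h f hf q p
  have h4 : 4 * ∫ z, f z * f z ∂μ ≤ (f q - f p) ^ 2 := by nlinarith [sq_nonneg (f q + f p)]
  have : C * ∫ z, f z * f z ∂μ ≤ ν * ∫ z, f z * f z ∂μ := by
    rw [← hff]
    nlinarith
  exact le_of_mul_le_mul_right this hpos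

end MetricGraph

/-! ### Cauchy–Schwarz and the variation along an edge -/

theorem sq_integral_abs_le {L : ℝ} (hL : 0 < L) {g : ℝ → ℝ}
    (hg : MemLp g 2 (volume.restrict (Ioo 0 L))) :
    (∫ t in Ioo 0 L, |g t|) ^ 2 ≤ L * ∫ t in Ioo 0 L, g t * g t := by
  set I := ∫ t in Ioo 0 L, |g t| with hI
  have i1 : Integrable (fun t => |g t|) (volume.restrict (Ioo 0 L)) :=
    (hg.integrable one_le_two).abs
  have i2 : Integrable (fun t => g t * g t) (volume.restrict (Ioo 0 L)) := hg.integrable_mul hg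
  have i3 : Integrable (fun t => L ^ 2 * (g t * g t) - 2 * L * I * |g t|)
      (volume.restrict (Ioo 0 L)) := (i2.const_mul _).sub (i1.const_mul _)
  -- The integrand is (L|g| - I)².
  have key : 0 ≤ ∫ t in Ioo 0 L, (L ^ 2 * (g t * g t) - 2 * L * I * |g t| + I ^ 2) := by
    refine integral_nonneg fun t => ?_
    simp only [Pi.zero_apply]
    nlinarith [sq_nonneg (L * |g t| - I), abs_mul_abs_self (g t)]
  rw [integral_add i3 (integrable_const _),
    integral_sub (i2.const_mul _) (i1.const_mul _), integral_const_mul, integral_const_mul,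
    ← hI] at key
  simp [hL.le] at key
  refine le_of_mul_le_mul_left ?_ hL
  nlinarith

namespace MetricGraph

variable {V E : Type*} {G : MetricGraph V E}

/-- The energy of a function on an edge. -/
noncomputable def edgeEnergy (f : G.Space → ℝ) (e : E) : ℝ :=
  ∫ t in Ioo 0 (G.len e), weakDeriv (G.len e) (G.onEdge f e) t * weakDeriv (G.len e) (G.onEdge f e) t

theorem edgeEnergy_nonneg (f : G.Space → ℝ) (e : E) : 0 ≤ edgeEnergy f e :=
  integral_nonneg fun _ => mul_self_nonneg _

/-- The variation along an edge. -/
theorem exists_variation {f : G.Space → ℝ} (hf : f ∈ G.H1) (e : E) :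
    ∃ A : ℝ → ℝ, (∀ s t, 0 ≤ s → s ≤ t → t ≤ G.len e →
      |f (G.edgePoint e t) - f (G.edgePoint e s)| ≤ A t - A s) ∧
      (A (G.len e) - A 0) ^ 2 ≤ G.len e * edgeEnergy f e := by
  have hL := G.len_pos e
  have hm := (hf.2 e).memLp_weakDeriv
  set g := weakDeriv (G.len e) (G.onEdge f e) with hg
  have hi : IntervalIntegrable (fun t => |g t|) volume 0 (G.len e) :=
    (intervalIntegrable_iff_integrableOn_Ioo_of_le hL.le).mpr (hm.integrable one_le_two).abs
  -- A primitive of |f'|, so that variations over adjacent pieces of the edge add up by linear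
  -- arithmetic.
  refine ⟨fun t => ∫ r in 0..t, |g r|, fun s t hs hst ht => ?_, ?_⟩
  · have i : ∀ r ∈ Icc 0 (G.len e), IntervalIntegrable (fun t => |g t|) volume 0 r := fun r hr =>
      hi.mono_set (by rw [uIcc_of_le hr.1, uIcc_of_le hL.le]; exact Icc_subset_Icc_right hr.2)
    have h1 := integral_weakDeriv_onEdge hf e ⟨hs, hst.trans ht⟩ ⟨hs.trans hst, ht⟩
    change _ = f (G.edgePoint e t) - f (G.edgePoint e s) at h1
    rw [intervalIntegral.integral_interval_sub_left (i t ⟨hs.trans hst, ht⟩) (i s ⟨hs, hst.trans ht⟩),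
      ← h1]
    exact intervalIntegral.abs_integral_le_integral_abs hst
  · simp only [intervalIntegral.integral_same, sub_zero]
    rw [intervalIntegral.integral_of_le hL.le, integral_Ioc_eq_integral_Ioo]
    exact sq_integral_abs_le hL hm

theorem exists_eq_edgePoint (h : ∀ v, ∃ e, G.src e = v ∨ G.tgt e = v) (x : G.Space) :
    ∃ e, ∃ t ∈ Icc 0 (G.len e), x = G.edgePoint e t := by
  rcases G.eq_vertex_or_edgePoint x with ⟨v, rfl⟩ | hx
  · obtain ⟨e, rfl | rfl⟩ := h v
    · exact ⟨e, 0, ⟨le_rfl, (G.len_pos e).le⟩, (G.edgePoint_zero e).symm⟩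
    · exact ⟨e, G.len e, ⟨(G.len_pos e).le, le_rfl⟩, (G.edgePoint_len e).symm⟩
  · exact hx

/-! ### Examples -/

theorem boundaryVolume_of_fin_two [Fintype E] {G : MetricGraph (Fin 2) E} (h0 : ∀ e, G.src e = 0)
    (h1 : ∀ e, G.tgt e = 1) {Y : Set (Fin 2)} (hY : Y.Nonempty) (hY' : Y ≠ univ) :
    G.boundaryVolume Y = ∑ e, 1 / G.len e := by
  classical
  have hb : ∀ e, e ∈ G.boundary Y := by
    intro e
    simp only [boundary, mem_ofPred_eq, h0, h1]
    by_cases a : (0 : Fin 2) ∈ Y <;> by_cases b : (1 : Fin 2) ∈ Y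
    · exact absurd (eq_univ_of_forall fun v => by fin_cases v <;> assumption) hY'
    · simp [a, b]
    · simp [a, b]
    · obtain ⟨v, hv⟩ := hY
      fin_cases v <;> contradiction
  simp only [boundaryVolume, hb, Finset.filter_true]

theorem pathGraph_isEssential : pathGraph.IsEssential := by
  refine Or.inl fun v => ?_
  fin_cases v <;> simp [degree, pathGraph]

theorem pathGraph_cheeger : pathGraph.cheeger = 1 := by
  have hv : ∀ Y : Set (Fin 2), Y.Nonempty → Y ≠ univ → pathGraph.boundaryVolume Y = 1 :=
    fun Y hY hY' => by
      rw [boundaryVolume_of_fin_two (fun _ => rfl) (fun _ => rfl) hY hY']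
      simp [pathGraph]
  refine le_antisymm ?_ (le_inf (le_inf ?_ ?_) ?_)
  · have hne : ({0} : Set (Fin 2)) ≠ univ := fun h => by simpa using h.symm.subset (mem_univ 1)
    refine (inf_le_left.trans inf_le_left).trans ((iInf₂_le {0} ⟨singleton_nonempty 0, hne⟩).trans ?_)
    rw [hv _ (singleton_nonempty 0) hne, ENNReal.ofReal_one]
  · exact le_iInf₂ fun Y hY => by rw [hv Y hY.1 hY.2, ENNReal.ofReal_one]
  · exact le_iInf fun e₁ => le_iInf₂ fun e₂ h => absurd (Subsingleton.elim e₁ e₂) h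
  · refine le_iInf fun e => ?_
    rw [← ENNReal.ofReal_one]
    exact ENNReal.ofReal_le_ofReal (by norm_num [pathGraph])

/-- On a unit interval the squared total variation is at most the energy, and it dominates every
squared difference of values. -/
theorem pathGraph_optimalEigenvalue : 4 ≤ pathGraph.optimalEigenvalue 1 := by
  rw [show (4 : ℝ≥0∞) = ENNReal.ofReal 4 by simp]
  refine le_optimalEigenvalue_one (by norm_num) fun f hf x y => ?_
  have hcov : ∀ v, ∃ e, pathGraph.src e = v ∨ pathGraph.tgt e = v := fun v =>
    ⟨(), by fin_cases v <;> simp [pathGraph]⟩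
  obtain ⟨A, hA, hA'⟩ := exists_variation hf ()
  obtain ⟨⟨⟩, s, hs, rfl⟩ := exists_eq_edgePoint hcov x
  obtain ⟨⟨⟩, t, ht, rfl⟩ := exists_eq_edgePoint hcov y
  have hE : pathGraph.energy f f = edgeEnergy f () := by simp [energy, edgeEnergy]
  rw [hE]
  have hlen : pathGraph.len () = 1 := rfl
  rw [hlen] at hA hA' hs ht
  wlog hst : s ≤ t generalizing s t
  · have := this t ht s hs (le_of_not_ge hst)
    linarith
  have h1 := hA s t hs.1 hst ht.2
  have h2 := (abs_nonneg _).trans (hA 0 s le_rfl hs.1 hs.2)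
  have h3 := (abs_nonneg _).trans (hA t 1 ht.1 ht.2 le_rfl)
  have h4 : |f (pathGraph.edgePoint () t) - f (pathGraph.edgePoint () s)| ≤ A 1 - A 0 := by linarith
  have h5 := sq_le_sq' (by linarith [abs_nonneg (f (pathGraph.edgePoint () t) - f (pathGraph.edgePoint () s))]) h4
  rw [sq_abs] at h5
  nlinarith

theorem circle_cheeger : circle.cheeger = 4 := by
  have h4 : ENNReal.ofReal (4 / circle.len ()) = 4 := by simp [circle]
  refine le_antisymm (inf_le_right.trans ((iInf_le _ ()).trans h4.le)) (le_inf (le_inf ?_ ?_) ?_)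
  · refine le_iInf₂ fun Y hY => ?_
    obtain ⟨⟨⟩, hv⟩ := hY.1
    exact absurd (eq_univ_of_forall fun _ => hv) hY.2
  · exact le_iInf fun e₁ => le_iInf₂ fun e₂ h => absurd (Subsingleton.elim e₁ e₂) h
  · exact le_iInf fun e => h4.ge

/-- Two points cut the circle into two arcs, each with variation at least |f(x)-f(y)|. The doubled
difference gains a factor 4 over the interval. -/
theorem circle_optimalEigenvalue : 16 ≤ circle.optimalEigenvalue 1 := by
  rw [show (16 : ℝ≥0∞) = ENNReal.ofReal 16 by simp]
  refine le_optimalEigenvalue_one (by norm_num) fun f hf x y => ?_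
  have hcov : ∀ v, ∃ e, circle.src e = v ∨ circle.tgt e = v := fun v => ⟨(), Or.inl rfl⟩
  obtain ⟨A, hA, hA'⟩ := exists_variation hf ()
  obtain ⟨⟨⟩, s, hs, rfl⟩ := exists_eq_edgePoint hcov x
  obtain ⟨⟨⟩, t, ht, rfl⟩ := exists_eq_edgePoint hcov y
  have hE : circle.energy f f = edgeEnergy f () := by simp [energy, edgeEnergy]
  rw [hE]
  have hlen : circle.len () = 1 := rfl
  have hloop : circle.edgePoint () 0 = circle.edgePoint () 1 :=
    (circle.edgePoint_zero ()).trans (circle.edgePoint_len ()).symm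
  rw [hlen] at hA hA' hs ht
  wlog hst : s ≤ t generalizing s t
  · have := this t ht s hs (le_of_not_ge hst)
    linarith
  have h1 := hA s t hs.1 hst ht.2
  have h2 := hA 0 s le_rfl hs.1 hs.2
  have h3 := hA t 1 ht.1 ht.2 le_rfl
  -- Joins the pieces [0,s] and [t,1] into the second arc.
  rw [hloop] at h2
  have h4 := abs_add_le (f (circle.edgePoint () 1) - f (circle.edgePoint () t))
    (f (circle.edgePoint () s) - f (circle.edgePoint () 1))
  rw [show f (circle.edgePoint () 1) - f (circle.edgePoint () t) +
    (f (circle.edgePoint () s) - f (circle.edgePoint () 1)) =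
    -(f (circle.edgePoint () t) - f (circle.edgePoint () s)) by ring, abs_neg] at h4
  set d := f (circle.edgePoint () t) - f (circle.edgePoint () s) with hd
  have h5 : 2 * |d| ≤ A 1 - A 0 := by linarith
  have h6 := sq_le_sq' (by linarith [abs_nonneg d]) h5
  rw [mul_pow, sq_abs, hd] at h6
  nlinarith

theorem pumpkin_isEssential {n : ℕ} (hn : 2 ≤ n) (h3 : 3 ≤ n) : (pumpkin n hn).IsEssential := by
  refine Or.inl fun v => ?_
  fin_cases v <;> simp [degree, pumpkin] <;> omega

theorem pumpkin_cheeger {n : ℕ} (hn : 2 ≤ n) : (pumpkin n hn).cheeger = 2 * n := by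
  have e2 : (2 * n : ℝ≥0∞) = ENNReal.ofReal (2 * n) := by
    rw [ENNReal.ofReal_mul (by norm_num), ENNReal.ofReal_natCast]
    simp
  have hn' : (2 : ℝ) ≤ n := by exact_mod_cast hn
  have hl : ∀ e, (pumpkin n hn).len e = 1 / n := fun _ => rfl
  rw [e2]
  refine le_antisymm ?_ (le_inf (le_inf ?_ ?_) ?_)
  -- The minimum is attained by two distinct edges, n + n; cuts give n² ≥ 2n and single edges give
  -- 4n.
  · refine (inf_le_left.trans inf_le_right).trans ((iInf_le _ (⟨0, by omega⟩ : Fin n)).trans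
      ((iInf₂_le (⟨1, by omega⟩ : Fin n) (by simp)).trans (ENNReal.ofReal_le_ofReal ?_)))
    simp only [hl, one_div_one_div]
    linarith
  · refine le_iInf₂ fun Y hY => ENNReal.ofReal_le_ofReal ?_
    rw [boundaryVolume_of_fin_two (fun _ => rfl) (fun _ => rfl) hY.1 hY.2]
    simp only [hl, one_div_one_div, Finset.sum_const, Finset.card_univ, Fintype.card_fin,
      nsmul_eq_mul]
    nlinarith
  · refine le_iInf fun e₁ => le_iInf₂ fun e₂ h => ENNReal.ofReal_le_ofReal ?_
    simp only [hl, one_div_one_div]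
    linarith
  · refine le_iInf fun e => ENNReal.ofReal_le_ofReal ?_
    simp only [hl, div_div_eq_mul_div, div_one]
    linarith

/-- On the pumpkin, twice the difference of two values of a function is at most its variation along
a cycle through the two points. -/
theorem pumpkin_two_mul_abs_le {n : ℕ} (hn : 2 ≤ n) {f : (pumpkin n hn).Space → ℝ}
    {A : Fin n → ℝ → ℝ}
    (hA : ∀ e s t, 0 ≤ s → s ≤ t → t ≤ (1 / n : ℝ) →
      |f ((pumpkin n hn).edgePoint e t) - f ((pumpkin n hn).edgePoint e s)| ≤ A e t - A e s)
    (x y : (pumpkin n hn).Space) :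
    ∃ i j, i ≠ j ∧ 2 * |f x - f y| ≤ (A i (1 / n) - A i 0) + (A j (1 / n) - A j 0) := by
  have hcov : ∀ v, ∃ e, (pumpkin n hn).src e = v ∨ (pumpkin n hn).tgt e = v := fun v =>
    ⟨⟨0, by omega⟩, by fin_cases v <;> simp [pumpkin]⟩
  obtain ⟨i, s, ⟨hs0, hs⟩, rfl⟩ := exists_eq_edgePoint hcov x
  obtain ⟨j, t, ⟨ht0, ht⟩, rfl⟩ := exists_eq_edgePoint hcov y
  have hlen : ∀ e, (pumpkin n hn).len e = 1 / n := fun _ => rfl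
  rw [hlen] at hs ht
  have hz : ∀ e, f ((pumpkin n hn).edgePoint e 0) = f ((pumpkin n hn).vertex 0) := fun e => by
    rw [edgePoint_zero]
    rfl
  have hone : ∀ e, f ((pumpkin n hn).edgePoint e (1 / n)) = f ((pumpkin n hn).vertex 1) :=
    fun e => by
      rw [← hlen e, edgePoint_len]
      rfl
  have hn0 : (0 : ℝ) ≤ 1 / n := by positivity
  by_cases hij : i = j
  · subst hij
    wlog hst : s ≤ t generalizing s t
    · obtain ⟨a, b, hab, h⟩ := this t ht0 ht s hs0 hs (le_of_not_ge hst)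
      exact ⟨a, b, hab, by rwa [abs_sub_comm]⟩
    have : Nontrivial (Fin n) := Fin.nontrivial_iff_two_le.mpr hn
    -- With both points on edge `i`, any other edge closes the cycle.
    obtain ⟨k, hk⟩ := exists_ne i
    refine ⟨i, k, hk.symm, ?_⟩
    have h1 := abs_le.mp (hA i s t hs0 hst ht)
    have h2 := abs_le.mp (hA i 0 s le_rfl hs0 hs)
    have h3 := abs_le.mp (hA i t (1 / n) ht0 ht le_rfl)
    have h4 := abs_le.mp (hA k 0 (1 / n) le_rfl hn0 le_rfl)
    rw [hz] at h2 h4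
    rw [hone] at h3 h4
    rcases abs_cases (f ((pumpkin n hn).edgePoint i s) - f ((pumpkin n hn).edgePoint i t)) with h | h <;>
      linarith [h.1, h1.1, h1.2, h2.1, h2.2, h3.1, h3.2, h4.1, h4.2]
  · refine ⟨i, j, hij, ?_⟩
    have h1 := abs_le.mp (hA i 0 s le_rfl hs0 hs)
    have h2 := abs_le.mp (hA i s (1 / n) hs0 hs le_rfl)
    have h3 := abs_le.mp (hA j 0 t le_rfl ht0 ht)
    have h4 := abs_le.mp (hA j t (1 / n) ht0 ht le_rfl)
    rw [hz] at h1 h3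
    rw [hone] at h2 h4
    rcases abs_cases (f ((pumpkin n hn).edgePoint i s) - f ((pumpkin n hn).edgePoint j t)) with h | h <;>
      linarith [h.1, h1.1, h1.2, h2.1, h2.2, h3.1, h3.2, h4.1, h4.2]

theorem pumpkin_optimalEigenvalue {n : ℕ} (hn : 2 ≤ n) :
    4 * (2 * n) ≤ (pumpkin n hn).optimalEigenvalue 1 := by
  have hn' : (0 : ℝ) < n := by exact_mod_cast (by omega : 0 < n)
  have e : (4 * (2 * n) : ℝ≥0∞) = ENNReal.ofReal (8 * n) := by
    rw [ENNReal.ofReal_mul (by norm_num), ENNReal.ofReal_natCast, ← mul_assoc]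
    norm_num
  rw [e]
  refine le_optimalEigenvalue_one (by positivity) fun f hf x y => ?_
  choose A hA hA' using fun e => exists_variation hf e
  have hlen : ∀ e, (pumpkin n hn).len e = 1 / n := fun _ => rfl
  simp only [hlen] at hA hA'
  obtain ⟨i, j, hij, h⟩ := pumpkin_two_mul_abs_le hn hA x y
  have hE : edgeEnergy f i + edgeEnergy f j ≤ (pumpkin n hn).energy f f := by
    have : (pumpkin n hn).energy f f = ∑ e, edgeEnergy f e := rfl
    rw [this, ← Finset.sum_pair hij]
    exact Finset.sum_le_univ_sum_of_nonneg (edgeEnergy_nonneg f)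
  have hi := hA' i
  have hj := hA' j
  set a := A i (1 / n) - A i 0
  set b := A j (1 / n) - A j 0
  have h6 := sq_le_sq' (by linarith [abs_nonneg (f x - f y)]) h
  rw [mul_pow, sq_abs] at h6
  -- Uses (a+b)² ≤ 2(a²+b²) and a², b² ≤ (1/n)·(energy of the edge).
  have h7 : 4 * (f x - f y) ^ 2 ≤ 2 * (1 / n * (pumpkin n hn).energy f f) := by
    have := mul_le_mul_of_nonneg_left hE (one_div_pos.mpr hn').le
    nlinarith [sq_nonneg (a - b)]
  have h8 := mul_le_mul_of_nonneg_left h7 (mul_nonneg zero_le_two hn'.le)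
  have h9 : 2 * (n : ℝ) * (2 * (1 / n * (pumpkin n hn).energy f f)) =
      4 * (pumpkin n hn).energy f f := by
    field_simp
    ring
  linarith

end MetricGraph

/-- Upper bound for the first optimal eigenvalue by the Cheeger-type constant, and its sharpness. -/
theorem mainTheorem11 :
    (∀ (V E : Type*) [Finite V] [Fintype E] (G : MetricGraph V E),
      G.optimalEigenvalue 1 ≤ 4 * G.cheeger) ∧
    (MetricGraph.pathGraph.IsEssential ∧
      MetricGraph.pathGraph.cheeger = 1 ∧
      MetricGraph.pathGraph.optimalEigenvalue 1 = 4 * MetricGraph.pathGraph.cheeger) ∧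
    (∀ (n : ℕ) (hn : 2 ≤ n),
      (3 ≤ n → (MetricGraph.pumpkin n hn).IsEssential) ∧
      (MetricGraph.pumpkin n hn).cheeger = 2 * n ∧
      (MetricGraph.pumpkin n hn).optimalEigenvalue 1 = 4 * (MetricGraph.pumpkin n hn).cheeger) ∧
    (MetricGraph.circle.IsEssential ∧
      MetricGraph.circle.cheeger = 4 ∧
      MetricGraph.circle.optimalEigenvalue 1 = 4 * MetricGraph.circle.cheeger) := by
  refine ⟨fun V E _ _ G => G.optimalEigenvalue_one_le_cheeger, ⟨MetricGraph.pathGraph_isEssential,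
    MetricGraph.pathGraph_cheeger, le_antisymm
      (MetricGraph.optimalEigenvalue_one_le_cheeger _) ?_⟩, fun n hn =>
    ⟨MetricGraph.pumpkin_isEssential hn, MetricGraph.pumpkin_cheeger hn, le_antisymm
      (MetricGraph.optimalEigenvalue_one_le_cheeger _) ?_⟩, ⟨Or.inr ⟨by simp, by simp⟩,
    MetricGraph.circle_cheeger, le_antisymm
      (MetricGraph.optimalEigenvalue_one_le_cheeger _) ?_⟩⟩
  · rw [MetricGraph.pathGraph_cheeger, mul_one]
    exact MetricGraph.pathGraph_optimalEigenvalue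
  · rw [MetricGraph.pumpkin_cheeger]
    exact MetricGraph.pumpkin_optimalEigenvalue hn
  · rw [MetricGraph.circle_cheeger]
    exact (show (4 * 4 : ℝ≥0∞) = 16 by norm_num).le.trans MetricGraph.circle_optimalEigenvalue
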